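/- Let $S$ be an Alexandroff space (arbitrary intersections of open sets are open), equipped with its specialization preorder, $s\le t$ iff $s\in\overline{\{t\}}$; equivalently, let $S$ be a preordered set, equipped with the topology whose open sets are exactly the upsets of $S$. Let $\mathcal{O}S$ be the frame of open sets of $S$, i.e. the frame of all upsets of $S$, and let $N(\mathcal{O}S)$ be the frame of nuclei on $\mathcal{O}S$, ordered pointwise; here a nucleus on a frame $L$ is a map $j:L\to L$ with $a\le j(a)$, $j(j(a))= j(a)$ and $j(a\wedge b)=j(a)\wedge j(b)$ for all $a,b\in L$. A frame is called spatial if it is isomorphic to the frame of open sets of some topological space. Let $S_0=S/{\sim}$ be the skeleton ($T_0$-reflection) of $S$, where $x\sim y$ iff $x\le y$ and $y\le x$, partially ordered by $[x]\le_0[y]$ iff $x\le y$. Let $\mathscr{T}_2$ be the infinite binary tree, i.e. the set of finite words over $\{0,1\}$ ordered by $s\le t$ iff $s$ is an initial segment of $t$. Then the following conditions are equivalent: (1) $N(\mathcal{O}S)$ is not spatial; (2) $\mathscr{T}_2$ is isomorphic to a subposet of $S_0$, i.e. to a subset of $S_0$ with the induced order; (3) $\mathscr{T}_2$ embeds isomorphically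 into $S$, i.e. there is an injective map $f:\mathscr{T}_2\to S$ such that $s\le t$ iff $f(s)\le f(t)$ for all $s,t\in\mathscr{T}_2$. -/

import Mathlib

universe u

/-- A frame is spatial if it is isomorphic to the frame of open sets of some topological space.
(The space may be taken in the universe of the frame without loss of generality, since the space of
points of the frame, that is of frame homomorphisms to `Prop`, lives there. An order isomorphism
between frames is the same thing as a frame isomorphism.) -/
def IsSpatialFrame (L : Type u) [Order.Frame L] : Prop :=
  ∃ (X : Type u) (_ : TopologicalSpace X), Nonempty (L ≃o TopologicalSpace.Opens X)

/-- The infinite binary tree: its nodes are the finite words over a two-letter alphabet. The root is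
the empty word, and the two children of a node `w` are `w ++ [false]` and `w ++ [true]`. -/
@[ext] structure InfBinaryTree : Type where
  /-- The word that encodes the path from the root to the node. -/
  path : List Bool

/-- The order of the tree: `s ≤ t` iff `s` lies on the path from the root to `t`, that is, iff the
word of `s` is an initial segment of the word of `t`. -/
instance InfBinaryTree.instPartialOrder : PartialOrder InfBinaryTree where
  le s t := s.path <+: t.path
  le_refl s := List.prefix_refl s.path
  le_trans _ _ _ h₁ h₂ := h₁.trans h₂
  le_antisymm _ _ h₁ h₂ := InfBinaryTree.ext (h₁.eq_of_length_le h₂.length_le)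

/-!
A prime element `q` of the frame of nuclei on a frame `L` gives the prime element `q ⊥` of `L`
(`Nucleus.infPrime_apply_bot`, proved by looking at closed nuclei). Conversely, a prime `p` of `L`
gives the largest nucleus fixing `p`, with values `p` and `⊤`, which is a prime element of the frame
of nuclei (`Nucleus.infPrime_ofInfPrime`). Consequently the frame of nuclei is spatial as soon as for each
nucleus `j` every fixed element of `j` is a meet of fixed primes
(`isSpatialFrame_nucleus_of_exists_infPrime`), and if it is spatial, then every nucleus `j ≠ ⊤`
fixes some prime (`exists_infPrime_fixed_of_isSpatialFrame_nucleus`). For the frame of upper sets of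
a preorder `S`, a prime is the complement of a nonempty directed lower set.

If the binary tree embeds in `S` via `f`, the nucleus `denseNucleus f`, which encodes the regular
open upper sets of the image of `f`, is not `⊤`. It fixes no prime: the complement `D` of a fixed
prime would contain two incomparable nodes of the tree, an upper bound of them in `D`, and then a
node of the tree above this bound, although incomparable nodes have no common upper bound in the
tree.

If the frame of nuclei is not spatial, there are a nucleus `j`, an upper set `U` with `j U = U`
and a point `x ∉ U` such that each fixed prime above `U` contains `x`. For `y ≥ x` outside `U`, the
set of points above `y` and outside `U` cannot be directed, since the complement of its lower
closure would then be a fixed prime. So there are two points above `y`, outside `U`, all of whose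
common upper bounds lie in `U`. Choosing these points as the children of `y` recursively embeds the
binary tree in `S`.
-/

/-! ### Spatial frames and prime elements -/

/-- The point of a frame given by a prime element `p`: the homomorphism to `Prop` that is false
exactly on the elements below `p`. -/
def Locale.PT.ofInfPrime {L : Type*} [Order.Frame L] {p : L} (hp : InfPrime p) : Locale.PT L where
  toFun a := ¬ a ≤ p
  map_inf' a b := by simp [hp.inf_le]
  map_top' := by simpa using hp.ne_top
  map_sSup' s := by simp [Prop.exists_iff]

/-- A frame is spatial if and only if it has enough primes. -/
theorem isSpatialFrame_iff_exists_infPrime {L : Type u} [Order.Frame L] :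
    IsSpatialFrame L ↔ ∀ a b : L, ¬ a ≤ b → ∃ q, InfPrime q ∧ b ≤ q ∧ ¬ a ≤ q := by
  constructor
  · rintro ⟨X, _, ⟨e⟩⟩ a b hab
    obtain ⟨x, hxa, hxb⟩ : ∃ x, x ∈ e a ∧ x ∉ e b := by
      by_contra! h
      exact hab (e.le_iff_le.1 h)
    -- The prime attached to a point is the complement of its closure.
    let C : TopologicalSpace.Opens X := ⟨(closure {x})ᶜ, isClosed_closure.isOpen_compl⟩
    have hC : ∀ c, c ≤ e.symm C ↔ x ∉ e c := by
      intro c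
      rw [e.le_symm_apply]
      refine ⟨fun h hx => h hx (subset_closure rfl), fun h y hy hyx => h ?_⟩
      obtain ⟨z, hz, rfl⟩ := mem_closure_iff.1 hyx _ (e c).isOpen hy
      exact hz
    refine ⟨e.symm C, ⟨fun h => ?_, fun {c d} h => ?_⟩, (hC b).2 hxb, fun h => (hC a).1 h hxa⟩
    · have := (hC ⊤).1 (h le_top)
      simp at this
    · rw [hC, hC]
      rw [hC, map_inf] at h
      exact not_and_or.1 h
  · intro h
    refine ⟨Locale.PT L, inferInstance,
      ⟨(OrderIso.ofSurjective (OrderEmbedding.ofMapLEIff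
        (fun a : L => (⟨{x | x a}, a, rfl⟩ : TopologicalSpace.Opens (Locale.PT L))) ?_) ?_)⟩⟩
    · intro a b
      refine ⟨fun hab => ?_, fun hab x hx => ?_⟩
      · by_contra hn
        obtain ⟨q, hq, hbq, haq⟩ := h a b hn
        exact hab (show Locale.PT.ofInfPrime hq ∈ _ from haq) hbq
      · exact (OrderHomClass.mono x hab : x a ≤ x b) hx
    · rintro ⟨_, a, rfl⟩
      exact ⟨a, rfl⟩

/-! ### Prime nuclei -/

namespace Nucleus

variable {L : Type*} [Order.Frame L]

/-- The closed nucleus `x ↦ a ⊔ x`. -/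
def closed (a : L) : Nucleus L where
  toFun x := a ⊔ x
  map_inf' x y := sup_inf_left a x y
  idempotent' x := by simp
  le_apply' x := le_sup_right

theorem closed_le_iff {a : L} {j : Nucleus L} : closed a ≤ j ↔ a ≤ j ⊥ := by
  refine ⟨fun h => le_sup_left.trans (h ⊥), fun h x => sup_le ?_ j.le_apply⟩
  exact h.trans (j.monotone bot_le)

open Classical in
/-- The largest nucleus fixing a prime `p`, whose only fixed elements are `p` and `⊤`. -/
noncomputable def ofInfPrime {p : L} (hp : InfPrime p) : Nucleus L where
  toFun x := if x ≤ p then p else ⊤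
  map_inf' x y := by
    by_cases hx : x ≤ p <;> by_cases hy : y ≤ p <;> simp [hp.inf_le, hx, hy]
  idempotent' x := by
    by_cases hx : x ≤ p <;> simp [hx]
  le_apply' x := by
    by_cases hx : x ≤ p <;> simp [hx]

theorem ofInfPrime_apply_of_le {p : L} (hp : InfPrime p) {x : L} (hx : x ≤ p) :
    ofInfPrime hp x = p :=
  if_pos hx

theorem le_ofInfPrime_iff {p : L} (hp : InfPrime p) {j : Nucleus L} :
    j ≤ ofInfPrime hp ↔ j p ≤ p := by
  refine ⟨fun h => (h p).trans_eq (ofInfPrime_apply_of_le hp le_rfl), fun h x => ?_⟩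
  by_cases hx : x ≤ p
  · exact ((j.monotone hx).trans h).trans_eq (ofInfPrime_apply_of_le hp hx).symm
  · exact le_top.trans_eq (if_neg hx).symm

theorem infPrime_ofInfPrime {p : L} (hp : InfPrime p) : InfPrime (ofInfPrime hp) := by
  refine ⟨fun h => hp.ne_top ?_, fun {j k} h => ?_⟩
  · have := (le_ofInfPrime_iff hp).1 (h le_top : (⊤ : Nucleus L) ≤ _)
    simpa using this
  · simp only [le_ofInfPrime_iff] at h ⊢
    exact hp.inf_le.1 h

/-- The value at `⊥` of a prime nucleus is prime. -/
theorem infPrime_apply_bot {q : Nucleus L} (hq : InfPrime q) : InfPrime (q ⊥) := by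
  refine ⟨fun h => hq.ne_top ?_, fun {a b} h => ?_⟩
  · rw [eq_top_iff]
    intro x
    exact (h (le_top : q ⊥ ≤ ⊤)).trans (q.monotone bot_le)
  · simp only [← closed_le_iff]
    refine hq.inf_le.1 fun x => ?_
    calc (a ⊔ x) ⊓ (b ⊔ x) = a ⊓ b ⊔ x := sup_inf_right _ _ _ |>.symm
      _ ≤ q x := sup_le (h.trans (q.monotone bot_le)) q.le_apply

end Nucleus

/-- If for every nucleus each fixed element is a meet of fixed primes, then the frame of nuclei is
spatial. -/
theorem isSpatialFrame_nucleus_of_exists_infPrime {L : Type u} [Order.Frame L]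
    (h : ∀ (j : Nucleus L) (a u : L), j u = u → ¬ a ≤ u →
      ∃ p, InfPrime p ∧ j p = p ∧ u ≤ p ∧ ¬ a ≤ p) :
    IsSpatialFrame (Nucleus L) := by
  rw [isSpatialFrame_iff_exists_infPrime]
  intro j k hjk
  obtain ⟨a, ha⟩ : ∃ a, ¬ j a ≤ k a := by
    by_contra! h
    exact hjk h
  obtain ⟨p, hp, hkp, hap, hjp⟩ := h k (j a) (k a) (k.idempotent a) ha
  refine ⟨_, Nucleus.infPrime_ofInfPrime hp, (Nucleus.le_ofInfPrime_iff hp).2 hkp.le, fun hj => ?_⟩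
  exact hjp ((j.monotone (k.le_apply.trans hap)).trans ((Nucleus.le_ofInfPrime_iff hp).1 hj))

theorem exists_infPrime_fixed_of_isSpatialFrame_nucleus {L : Type u} [Order.Frame L]
    (h : IsSpatialFrame (Nucleus L)) {j : Nucleus L} (hj : j ≠ ⊤) :
    ∃ p, InfPrime p ∧ j p = p := by
  obtain ⟨q, hq, hjq, -⟩ := isSpatialFrame_iff_exists_infPrime.1 h ⊤ j (by rwa [top_le_iff])
  exact ⟨q ⊥, Nucleus.infPrime_apply_bot hq,
    ((hjq _).trans_eq (q.idempotent ⊥)).antisymm j.le_apply⟩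

/-! ### Primes in the frame of upper sets -/

section UpperSets

variable {S : Type*} [Preorder S] [TopologicalSpace S] [Topology.IsUpperSet S]

theorem TopologicalSpace.Opens.isUpperSet (U : TopologicalSpace.Opens S) :
    IsUpperSet (U : Set S) :=
  Topology.IsUpperSet.isOpen_iff_isUpperSet.1 U.isOpen

/-- The open set underlying an upper set. -/
def IsUpperSet.toOpens {s : Set S} (hs : IsUpperSet s) : TopologicalSpace.Opens S :=
  ⟨s, Topology.IsUpperSet.isOpen_iff_isUpperSet.2 hs⟩

/-- The complement of a prime open upper set is directed. -/
theorem InfPrime.exists_ge_ge_notMem {P : TopologicalSpace.Opens S} (hP : InfPrime P) {a b : S}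
    (ha : a ∉ P) (hb : b ∉ P) : ∃ z, a ≤ z ∧ b ≤ z ∧ z ∉ P := by
  by_contra! h
  have hab : (isUpperSet_Ici a).toOpens ⊓ (isUpperSet_Ici b).toOpens ≤ P :=
    fun z hz => h z hz.1 hz.2
  rcases hP.inf_le.1 hab with h | h
  · exact ha (h (le_refl a))
  · exact hb (h (le_refl b))

/-- A nucleus on the upper sets is local: membership of `y` in `j V` depends only on the part of
`V` above `y`. -/
theorem Nucleus.mem_of_forall_ge {j : Nucleus (TopologicalSpace.Opens S)}
    {V W : TopologicalSpace.Opens S} {y : S} (hy : y ∈ j V) (h : ∀ z ∈ V, y ≤ z → z ∈ W) :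
    y ∈ j W := by
  let Y := (isUpperSet_Ici y).toOpens
  have hY : y ∈ j Y := (j.le_apply : Y ≤ j Y) (le_refl y)
  have hVY : y ∈ j (V ⊓ Y) := by
    rw [j.map_inf]
    exact ⟨hy, hY⟩
  exact j.monotone (fun z hz => h z hz.1 hz.2 : V ⊓ Y ≤ W) hVY

/-- If the points above `y` outside a fixed open set `U` form a nonempty directed set, then the
complement of the lower closure of this set is a fixed prime. -/
theorem Nucleus.exists_infPrime_of_directed {j : Nucleus (TopologicalSpace.Opens S)}
    {U : TopologicalSpace.Opens S} (hU : j U = U) {y : S} (hy : y ∉ U)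
    (hd : ∀ a b, y ≤ a → a ∉ U → y ≤ b → b ∉ U → ∃ z, a ≤ z ∧ b ≤ z ∧ z ∉ U) :
    ∃ P, InfPrime P ∧ j P = P ∧ U ≤ P ∧ y ∉ P := by
  have hup : IsUpperSet {w : S | ∀ z, y ≤ z → w ≤ z → z ∈ U} :=
    fun a b hab ha z hyz hbz => ha z hyz (hab.trans hbz)
  refine ⟨hup.toOpens, ⟨fun h => ?_, fun {V W} h => ?_⟩, ?_, ?_, fun h => hy (h y le_rfl le_rfl)⟩
  · exact hy ((h le_top : ⊤ ≤ hup.toOpens) (TopologicalSpace.Opens.mem_top y) y le_rfl le_rfl)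
  · by_contra! hn
    obtain ⟨⟨v, hvV, hv⟩, w, hwW, hw⟩ := And.imp Set.not_subset.1 Set.not_subset.1 hn
    have hv' : ¬ ∀ z, y ≤ z → v ≤ z → z ∈ U := hv
    have hw' : ¬ ∀ z, y ≤ z → w ≤ z → z ∈ U := hw
    push Not at hv' hw'
    obtain ⟨a, hya, hva, haU⟩ := hv'
    obtain ⟨b, hyb, hwb, hbU⟩ := hw'
    obtain ⟨z, haz, hbz, hzU⟩ := hd a b hya haU hyb hbU
    exact hzU (h ⟨V.isUpperSet (hva.trans haz) hvV, W.isUpperSet (hwb.trans hbz) hwW⟩ z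
      (hya.trans haz) le_rfl)
  · refine le_antisymm (fun w hw z hyz hwz => ?_) j.le_apply
    rw [← hU]
    exact Nucleus.mem_of_forall_ge ((j hup.toOpens).isUpperSet hwz hw)
      fun t ht hzt => ht t (hyz.trans hzt) le_rfl
  · exact fun w hw z _ hwz => U.isUpperSet hwz hw

/-! ### The tree yields a nucleus without fixed primes -/

/-- The nucleus sending `U` to the set of points `x` such that `U` is cofinal in the part of the
image of `f` above `x`. Its fixed elements correspond to the regular open upper sets of the
image. -/
def denseNucleus {T : Type*} (f : T → S) : Nucleus (TopologicalSpace.Opens S) where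
  toFun U := IsUpperSet.toOpens (s := {x | ∀ s, x ≤ f s → ∃ t, f s ≤ f t ∧ f t ∈ U})
    fun _ _ hab ha s hs => ha s (hab.trans hs)
  map_inf' U V := by
    ext x
    refine ⟨fun h => ⟨fun s hs => ?_, fun s hs => ?_⟩, fun h s hs => ?_⟩
    · obtain ⟨t, hst, ht⟩ := h s hs
      exact ⟨t, hst, ht.1⟩
    · obtain ⟨t, hst, ht⟩ := h s hs
      exact ⟨t, hst, ht.2⟩
    · obtain ⟨t, hst, ht⟩ := h.1 s hs
      obtain ⟨r, htr, hr⟩ := h.2 t (hs.trans hst)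
      exact ⟨r, hst.trans htr, U.isUpperSet htr ht, hr⟩
  idempotent' U := by
    intro x h s hs
    obtain ⟨t, hst, ht⟩ := h s hs
    obtain ⟨r, htr, hr⟩ := ht t le_rfl
    exact ⟨r, hst.trans htr, hr⟩
  le_apply' U := fun x hx s hs => ⟨s, le_rfl, U.isUpperSet hs hx⟩

theorem mem_denseNucleus {T : Type*} {f : T → S} {U : TopologicalSpace.Opens S} {x : S} :
    x ∈ denseNucleus f U ↔ ∀ s, x ≤ f s → ∃ t, f s ≤ f t ∧ f t ∈ U :=
  Iff.rfl

theorem InfBinaryTree.exists_disjoint_above (s : InfBinaryTree) :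
    ∃ a b, s ≤ a ∧ s ≤ b ∧ ∀ t, a ≤ t → ¬ b ≤ t := by
  refine ⟨⟨s.path ++ [false]⟩, ⟨s.path ++ [true]⟩, List.prefix_append _ _, List.prefix_append _ _,
    fun t ha hb => ?_⟩
  have := (List.prefix_of_prefix_length_le ha hb (by simp)).eq_of_length (by simp)
  simp at this

theorem not_infPrime_of_denseNucleus_eq (f : InfBinaryTree ↪o S) {P : TopologicalSpace.Opens S}
    (hfix : denseNucleus f P = P) : ¬ InfPrime P := by
  intro hP
  have key : ∀ x, x ∉ P → ∃ s, x ≤ f s ∧ ∀ t, s ≤ t → f t ∉ P := by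
    intro x hx
    rw [← hfix, mem_denseNucleus] at hx
    push Not at hx
    obtain ⟨s, hs, h⟩ := hx
    exact ⟨s, hs, fun t hst => h t (f.le_iff_le.2 hst)⟩
  obtain ⟨x, hx⟩ : ∃ x, x ∉ P := by
    by_contra! h
    exact hP.ne_top (top_le_iff.1 fun x _ => h x)
  obtain ⟨s, -, hs⟩ := key x hx
  obtain ⟨a, b, hsa, hsb, hab⟩ := s.exists_disjoint_above
  obtain ⟨z, haz, hbz, hz⟩ := hP.exists_ge_ge_notMem (hs a hsa) (hs b hsb)
  obtain ⟨t, hzt, -⟩ := key z hz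
  exact hab t (f.le_iff_le.1 (haz.trans hzt)) (f.le_iff_le.1 (hbz.trans hzt))

theorem denseNucleus_ne_top (f : InfBinaryTree ↪o S) : denseNucleus f ≠ ⊤ := by
  intro h
  have hmem : f ⟨[]⟩ ∈ denseNucleus f ⊥ := by
    rw [h]
    exact TopologicalSpace.Opens.mem_top _
  obtain ⟨t, -, ht⟩ := hmem ⟨[]⟩ le_rfl
  exact ht

end UpperSets

/-! ### Embedding the tree -/

/-- If every point `y` has two children above it with no common upper bound, then iterating the
choice of children embeds the binary tree. -/
theorem nonempty_infBinaryTree_orderEmbedding {A : Type*} [Preorder A] [Nonempty A]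
    (h : ∀ y : A, ∃ a b, y ≤ a ∧ y ≤ b ∧ ∀ z, a ≤ z → ¬ b ≤ z) :
    Nonempty (InfBinaryTree ↪o A) := by
  choose a b ha hb hab using h
  let step : A → Bool → A := fun y c => bif c then b y else a y
  have hstep : ∀ y c, y ≤ step y c := by
    rintro y (_ | _)
    exacts [ha y, hb y]
  have hdisj : ∀ y c d z, c ≠ d → step y c ≤ z → ¬ step y d ≤ z := by
    rintro y (_ | _) (_ | _) z hcd h₁ h₂
    exacts [hcd rfl, hab y z h₁ h₂, hab y z h₂ h₁, hcd rfl]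
  have hle : ∀ (l : List Bool) (y : A), y ≤ l.foldl step y := by
    intro l
    induction l with
    | nil => exact fun y => le_rfl
    | cons c l ih => exact fun y => (hstep y c).trans (ih _)
  have hpre : ∀ (s t : List Bool) (y : A), s.foldl step y ≤ t.foldl step y → s <+: t := by
    intro s
    induction s with
    | nil => exact fun t y _ => List.nil_prefix
    | cons c s ih =>
      rintro (_ | ⟨d, t⟩) y hst
      · -- Here `step y c ≤ y`, so the other child of `y` is a common upper bound of the children.
        have hy : step y c ≤ y := (hle s _).trans hst
        exact (hdisj y c (!c) _ (by simp) (hy.trans (hstep y (!c))) le_rfl).elim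
      · by_cases hcd : c = d
        · subst hcd
          exact List.cons_prefix_cons.2 ⟨rfl, ih t _ hst⟩
        · exact (hdisj y c d _ hcd ((hle s _).trans hst) (hle t _)).elim
  obtain ⟨x⟩ := ‹Nonempty A›
  have hiff : ∀ s t : InfBinaryTree, s.path.foldl step x ≤ t.path.foldl step x ↔ s ≤ t := by
    refine fun s t => ⟨hpre _ _ x, fun hst => ?_⟩
    obtain ⟨r, hr⟩ := hst
    rw [← hr, List.foldl_append]
    exact hle _ _
  -- `A` is only a preorder; injectivity comes from antisymmetry of the tree.
  exact ⟨⟨⟨fun s => s.path.foldl step x, fun s t hst =>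
    le_antisymm ((hiff s t).1 hst.le) ((hiff t s).1 hst.ge)⟩, hiff _ _⟩⟩

theorem nonempty_infBinaryTree_orderEmbedding_of_not_isSpatialFrame {S : Type u} [Preorder S]
    [TopologicalSpace S] [Topology.IsUpperSet S]
    (h : ¬ IsSpatialFrame (Nucleus (TopologicalSpace.Opens S))) :
    Nonempty (InfBinaryTree ↪o S) := by
  by_contra hS
  refine h (isSpatialFrame_nucleus_of_exists_infPrime fun j V U hU hVU => ?_)
  obtain ⟨x, hxV, hxU⟩ := Set.not_subset.1 hVU
  by_contra! hn
  -- The tree is built inside the set of points above `x` and outside `U`.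
  let A := {y : S // x ≤ y ∧ y ∉ U}
  have : Nonempty A := ⟨⟨x, le_rfl, hxU⟩⟩
  suffices Nonempty (InfBinaryTree ↪o A) from
    hS (this.map fun f => f.trans (OrderEmbedding.subtype _))
  refine nonempty_infBinaryTree_orderEmbedding ?_
  rintro ⟨y, hxy, hyU⟩
  by_contra! hA
  obtain ⟨P, hP, hjP, hUP, hyP⟩ := Nucleus.exists_infPrime_of_directed hU hyU
    fun a b hya haU hyb hbU => by
      obtain ⟨z, haz, hbz⟩ := hA ⟨a, hxy.trans hya, haU⟩ ⟨b, hxy.trans hyb, hbU⟩ hya hyb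
      exact ⟨z, haz, hbz, z.2.2⟩
  exact hyP (P.isUpperSet hxy (hn P hP hjP hUP hxV))

/-- `S` is an Alexandroff space together with its specialization preorder: `Topology.IsUpperSet S`
says that the open sets are exactly the upper sets of the preorder. The skeleton of `S` is
`Antisymmetrization S (· ≤ ·)`, with the order `[x] ≤ [y] ↔ x ≤ y`. -/
theorem mainTheorem2 (S : Type u) [Preorder S] [TopologicalSpace S] [Topology.IsUpperSet S] :
    List.TFAE
      [¬ IsSpatialFrame (Nucleus (TopologicalSpace.Opens S)),
        ∃ A : Set (Antisymmetrization S (· ≤ ·)), Nonempty (InfBinaryTree ≃o A),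
        Nonempty (InfBinaryTree ↪o S)] := by
  tfae_have 1 → 3 := nonempty_infBinaryTree_orderEmbedding_of_not_isSpatialFrame
  tfae_have 3 → 1 := by
    rintro ⟨f⟩ h
    obtain ⟨P, hP, hfix⟩ :=
      exists_infPrime_fixed_of_isSpatialFrame_nucleus h (denseNucleus_ne_top f)
    exact not_infPrime_of_denseNucleus_eq f hfix hP
  tfae_have 2 → 3 := by
    rintro ⟨A, ⟨e⟩⟩
    exact ⟨e.toOrderEmbedding.trans
      ((OrderEmbedding.subtype _).trans (OrderEmbedding.ofAntisymmetrization S))⟩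
  tfae_have 3 → 2 := by
    rintro ⟨f⟩
    let g : InfBinaryTree ↪o Antisymmetrization S (· ≤ ·) :=
      OrderEmbedding.ofMapLEIff (fun s => toAntisymmetrization (· ≤ ·) (f s))
        fun s t => toAntisymmetrization_le_toAntisymmetrization_iff.trans f.le_iff_le
    exact ⟨Set.range g, ⟨g.orderIso⟩⟩
  tfae_finish
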